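/- Let $L$ be a separable complex Hilbert space with $\dim L=\infty$, equipped with a conjugation $f\mapsto\bar f$ (an antilinear isometric involution); inner products are linear in the second argument. Let $a(f)$, $a^\dagger(f)$, $f\in L$, be a Fock representation of the canonical anti-commutation relations over $L$ on a complex Hilbert space $\mathcal F$. That is, $f\mapsto a(f)$ and $f\mapsto a^\dagger(f)$ are linear, the operators have a common dense domain that they leave invariant, and on it $\{a(f),a(g)\}=0=\{a^\dagger(f),a^\dagger(g)\}$, $\{a(f),a^\dagger(g)\}=(\bar f,g)\,\mathrm{id}$ and $a(f)^*=a^\dagger(\bar f)$ (the operators are then bounded and are extended to all of $\mathcal F$); moreover there is a unit vector $\Omega\in\mathcal F$ with $a(f)\Omega=0$ for all $f\in L$ such that the vectors $a^\dagger(f_n)\cdots a^\dagger(f_1)\Omega$, $n\ge 0$, $f_j\in L$, span a dense subspace of $\mathcal F$. Let $\mathcal F^{(n)}$ be the closed span of the vectors $a^\dagger(f_n)\cdots a^\dagger(f_1)\Omega$ with $n$ factors, and let $\mathcal F_0$ be the linear span of all $\mathcal F^{(n)}$, $n\ge0$. For a bounded operator $B$ on $L$ define on $\mathcal F_0$ $$d\Gamma(B)=\sum_j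 a^\dagger(Be_j)\,a(\bar e_j),\qquad N=d\Gamma(\mathrm{id}),$$ where $\{e_j\}$ is a complete orthonormal system in $L$; the powers $N^s$, $s\ge 0$, are defined by the spectral resolution of $N$, so that $N^s\Phi=n^s\Phi$ for $\Phi\in\mathcal F^{(n)}$ (with $0^0=1$). For $1\le p<\infty$ let $B_p(L)$ be the von Neumann–Schatten class of the operators $\sum_j\mu_j(e_j,\cdot)f_j$ with orthonormal systems $\{e_j\}$, $\{f_j\}$ in $L$ and singular values $\mu_j\ge0$ such that $\sum_j\mu_j^p<\infty$; $B_1(L)$ is the trace class. Let $B$ be a bounded operator on $L$, let $1\le r<\infty$ and $s=\frac{2(r-1)}{r}$, and suppose that there are real constants $\gamma,\delta$ with $$d\Gamma(B)^*d\Gamma(B)\le \gamma N^s+\delta\,\mathrm{id}$$ in the sense of quadratic forms on $\mathcal F_0$, i.e. $\|d\Gamma(B)\Phi\|^2\le(\Phi,(\gamma N^s+\delta)\Phi)$ for all $\Phi\in\mathcal F_0$. If $s=0$, then $B\in B_1(L)$. If $0<s<2$, then $B\in B_{r+\varepsilon}(L)$ for every $\varepsilon>0$. -/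

import Mathlib

noncomputable section

universe u v

/-- A conjugation on a complex Hilbert space: an antilinear isometric involution. -/
structure Conjugation (L : Type u) [NormedAddCommGroup L] [InnerProductSpace ℂ L] where
  conj : L →ₗᵢ⋆[ℂ] L
  conj_conj : ∀ f, conj (conj f) = f

/-- A representation of the canonical anti-commutation relations over `L` on a complex Hilbert
space `F`. The operators `ann f` and `cre f` depend linearly on `f`, have the common dense domain
`dom`, and leave it invariant; nothing is assumed about their boundedness. -/
structure CARRepresentation (L : Type u) [NormedAddCommGroup L] [InnerProductSpace ℂ L]
    (J : Conjugation L) (F : Type v) [NormedAddCommGroup F] [InnerProductSpace ℂ F] where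
  dom : Submodule ℂ F
  dense_dom : Dense (dom : Set F)
  ann : L →ₗ[ℂ] Module.End ℂ dom
  cre : L →ₗ[ℂ] Module.End ℂ dom
  ann_ann : ∀ f g, ann f * ann g + ann g * ann f = 0
  cre_cre : ∀ f g, cre f * cre g + cre g * cre f = 0
  ann_cre : ∀ f g, ann f * cre g + cre g * ann f = (inner ℂ (J.conj f) g : ℂ) • 1
  /-- `a(f)* = a†(f̄)` on the common domain. -/
  unitarity : ∀ f (x y : dom),
    (inner ℂ ((ann f x : dom) : F) (y : F) : ℂ) = inner ℂ (x : F) ((cre (J.conj f) y : dom) : F)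

namespace CARRepresentation

variable {L : Type u} [NormedAddCommGroup L] [InnerProductSpace ℂ L] {J : Conjugation L}
  {F : Type v} [NormedAddCommGroup F] [InnerProductSpace ℂ F]

theorem norm_sq_add_norm_sq (R : CARRepresentation L J F) (f : L) (x : R.dom) :
    ‖((R.ann f x : R.dom) : F)‖ ^ 2 + ‖((R.cre (J.conj f) x : R.dom) : F)‖ ^ 2
      = ‖f‖ ^ 2 * ‖(x : F)‖ ^ 2 := by
  have h1 := R.unitarity f x (R.ann f x)
  have h2 := R.unitarity f (R.cre (J.conj f) x) x
  have h3 := congrArg (fun T : Module.End ℂ R.dom => ((T x : R.dom) : F))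
    (R.ann_cre f (J.conj f))
  simp only [LinearMap.add_apply, Module.End.mul_apply, LinearMap.smul_apply,
    Module.End.one_apply, Submodule.coe_add, Submodule.coe_smul] at h3
  have h4 := congrArg (fun z : F => (inner ℂ (x : F) z : ℂ)) h3
  simp only [inner_add_right, inner_smul_right] at h4
  rw [← h1, ← inner_conj_symm (x : F), h2, inner_conj_symm] at h4
  simp only [inner_self_eq_norm_sq_to_K, LinearIsometry.norm_map] at h4
  apply Complex.ofReal_injective
  push_cast
  rw [add_comm]
  exact h4

theorem norm_ann_le (R : CARRepresentation L J F) (f : L) (x : R.dom) :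
    ‖((R.ann f x : R.dom) : F)‖ ≤ ‖f‖ * ‖(x : F)‖ := by
  refine le_of_sq_le_sq ?_ (by positivity)
  nlinarith [R.norm_sq_add_norm_sq f x, sq_nonneg ‖((R.cre (J.conj f) x : R.dom) : F)‖]

theorem norm_cre_le (R : CARRepresentation L J F) (f : L) (x : R.dom) :
    ‖((R.cre f x : R.dom) : F)‖ ≤ ‖f‖ * ‖(x : F)‖ := by
  have h := R.norm_sq_add_norm_sq (J.conj f) x
  rw [J.conj_conj, LinearIsometry.norm_map] at h
  refine le_of_sq_le_sq ?_ (by positivity)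
  nlinarith [sq_nonneg ‖((R.ann (J.conj f) x : R.dom) : F)‖]

theorem denseRange_subtype (R : CARRepresentation L J F) : DenseRange R.dom.subtype := by
  simpa [DenseRange] using R.dense_dom

variable [CompleteSpace F]

/-- The annihilation operator `a(f)`, extended by continuity to all of `F`. -/
def annihilate (R : CARRepresentation L J F) (f : L) : F →L[ℂ] F :=
  (R.dom.subtype ∘ₗ R.ann f).extendOfNorm R.dom.subtype

/-- The creation operator `a†(f)`, extended by continuity to all of `F`. -/
def create (R : CARRepresentation L J F) (f : L) : F →L[ℂ] F :=
  (R.dom.subtype ∘ₗ R.cre f).extendOfNorm R.dom.subtype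

theorem annihilate_coe (R : CARRepresentation L J F) (f : L) (x : R.dom) :
    R.annihilate f x = (R.ann f x : R.dom) :=
  LinearMap.extendOfNorm_eq R.denseRange_subtype ⟨‖f‖, R.norm_ann_le f⟩ x

theorem create_coe (R : CARRepresentation L J F) (f : L) (x : R.dom) :
    R.create f x = (R.cre f x : R.dom) :=
  LinearMap.extendOfNorm_eq R.denseRange_subtype ⟨‖f‖, R.norm_cre_le f⟩ x

/-- `a†(fₙ) ⋯ a†(f₁) Ω` for the list `[fₙ, …, f₁]`. -/
def createList (R : CARRepresentation L J F) (Ω : F) : List L → F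
  | [] => Ω
  | f :: l => R.create f (createList R Ω l)

end CARRepresentation

/-- A Fock representation of the CAR: a representation with a normalized vacuum vector which is
annihilated by all `a(f)` and cyclic for the `a†(f)`. -/
structure FockRepresentation (L : Type u) [NormedAddCommGroup L] [InnerProductSpace ℂ L]
    (J : Conjugation L) (F : Type v) [NormedAddCommGroup F] [InnerProductSpace ℂ F]
    [CompleteSpace F] extends CARRepresentation L J F where
  vacuum : F
  norm_vacuum : ‖vacuum‖ = 1
  annihilate_vacuum : ∀ f, toCARRepresentation.annihilate f vacuum = 0
  cyclic : (Submodule.span ℂ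
    (Set.range (toCARRepresentation.createList vacuum))).topologicalClosure = ⊤

namespace FockRepresentation

variable {L : Type u} [NormedAddCommGroup L] [InnerProductSpace ℂ L] {J : Conjugation L}
  {F : Type v} [NormedAddCommGroup F] [InnerProductSpace ℂ F] [CompleteSpace F]

/-- The `n`-particle space, the closed span of the vectors `a†(fₙ) ⋯ a†(f₁) Ω`. -/
def nParticle (R : FockRepresentation L J F) (n : ℕ) : Submodule ℂ F :=
  (Submodule.span ℂ
    {Φ | ∃ l : List L, l.length = n ∧ R.createList R.vacuum l = Φ}).topologicalClosure

/-- The (algebraic) span of all `n`-particle spaces: the vectors of finite particle number. -/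
def finiteParticle (R : FockRepresentation L J F) : Submodule ℂ F :=
  ⨆ n, R.nParticle n

/-- The second quantization `dΓ(B) = ∑ⱼ a†(B eⱼ) a(ēⱼ)`, for a complete orthonormal system `e`.
For bounded `B` the series converges at every vector of finite particle number, and
`R.finiteParticle` is the domain on which `dΓ(B)` is considered. -/
def dGamma (R : FockRepresentation L J F) {ι : Type*} (e : HilbertBasis ι ℂ L)
    (B : L →L[ℂ] L) (Φ : F) : F :=
  ∑' j, R.create (B (e j)) (R.annihilate (J.conj (e j)) Φ)

/-- The number operator `N = dΓ(1)`. -/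
def number (R : FockRepresentation L J F) {ι : Type*} (e : HilbertBasis ι ℂ L) (Φ : F) : F :=
  R.dGamma e (ContinuousLinearMap.id ℂ L) Φ

/-- The closed spectral subspace of the number operator for the eigenvalue `n`. -/
def numberEigenspace (R : FockRepresentation L J F) {ι : Type*} (e : HilbertBasis ι ℂ L)
    (n : ℕ) : Submodule ℂ F :=
  (Submodule.span ℂ
    {Φ | Φ ∈ R.finiteParticle ∧ R.number e Φ = (n : ℂ) • Φ}).topologicalClosure

instance (R : FockRepresentation L J F) {ι : Type*} (e : HilbertBasis ι ℂ L) (n : ℕ) :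
    CompleteSpace (R.numberEigenspace e n) :=
  Submodule.topologicalClosure.completeSpace _

/-- The power `N ^ s` of the number operator, through its spectral resolution
`N ^ s = ∑ₙ n ^ s Eₙ`, where `Eₙ` is the orthogonal projection onto the eigenspace for `n`
(so `N ^ 0` is the identity). On vectors of finite particle number the sum is finite. -/
def numberPow (R : FockRepresentation L J F) {ι : Type*} (e : HilbertBasis ι ℂ L) (s : ℝ)
    (Φ : F) : F :=
  ∑' n : ℕ, (((n : ℝ) ^ s : ℝ) : ℂ) • (R.numberEigenspace e n).starProjection Φ

/-- The operator inequality `dΓ(B)* dΓ(B) ≤ γ N ^ s + δ`, as an inequality of quadratic forms on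
the vectors of finite particle number; note `⟪Φ, dΓ(B)* dΓ(B) Φ⟫ = ‖dΓ(B) Φ‖ ^ 2`. -/
def NumberBound (R : FockRepresentation L J F) {ι : Type*} (e : HilbertBasis ι ℂ L)
    (B : L →L[ℂ] L) (γ δ s : ℝ) : Prop :=
  ∀ Φ ∈ R.finiteParticle,
    ‖R.dGamma e B Φ‖ ^ 2
      ≤ (inner ℂ Φ ((γ : ℂ) • R.numberPow e s Φ + (δ : ℂ) • Φ) : ℂ).re

end FockRepresentation

/-- Membership in the von Neumann-Schatten class of exponent `p` (`1 ≤ p < ∞`): `B` has a singular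
value decomposition `B = ∑ⱼ μⱼ ⟪eⱼ, ·⟫ fⱼ` with orthonormal systems `e`, `f` and singular values
`μⱼ ≥ 0` whose `p`-th powers are summable. For `p = 1` this is the trace class. -/
def IsSchatten {L : Type u} [NormedAddCommGroup L] [InnerProductSpace ℂ L] (p : ℝ)
    (B : L →L[ℂ] L) : Prop :=
  ∃ (κ : Type u) (μ : κ → ℝ) (e f : κ → L),
    (∀ j, 0 ≤ μ j) ∧ Orthonormal ℂ e ∧ Orthonormal ℂ f ∧
    (∀ x, HasSum (fun j => ((μ j : ℂ) * inner ℂ (e j) x) • f j) (B x)) ∧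
    Summable (fun j => μ j ^ p)

end

/-! Test the bound on Slater determinants `a†(v₁)⋯a†(vₙ)Ω` with orthonormal `vᵢ`. Such a vector has
norm one, `N` acts on it as `n`, and the expectation of `dΓ(B)` in it is the partial trace `∑ (vᵢ, B
vᵢ)`. By Cauchy–Schwarz this partial trace is `O(n^(s/2))`, where `s/2 = 1 - 1/r < 1`
(`NumberBound.norm_sum_inner_sq_le`).

The estimate holds for all finite orthonormal systems and their subsets. Diagonalizing a
self-adjoint operator of finite rank therefore yields the same growth for `∑ (gⱼ, B fⱼ)` with any
two orthonormal systems `f`, `g` (`PartialTraceBound.norm_sum_inner_le`). Sublinear growth forces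
`B` to be compact (`isCompactOperator_of_norm_sum_inner_le`), so `B` has a singular value
decomposition.

With the singular vectors as `f` and `g`, any `n` singular values add up to at most `C n^(1-1/r)`.
For `r = 1` this is summability. For `r > 1` the `n`-th largest singular value is at most `C
n^(-1/r)`, so the powers `p > r` are summable (`summable_rpow_of_sum_le_mul_card_rpow`). -/

noncomputable section

/-! ### The anti-commutation relations for the extended operators. -/

namespace CARRepresentation

variable {L : Type*} [NormedAddCommGroup L] [InnerProductSpace ℂ L] {J : Conjugation L}
  {F : Type*} [NormedAddCommGroup F] [InnerProductSpace ℂ F] [CompleteSpace F]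
  (R : CARRepresentation L J F)

theorem norm_create_apply_le (f : L) (x : F) : ‖R.create f x‖ ≤ ‖f‖ * ‖x‖ := by
  refine R.denseRange_subtype.induction_on x
    (isClosed_le (by fun_prop) (by fun_prop)) fun y => ?_
  simpa [R.create_coe] using R.norm_cre_le f y

theorem create_add (f g : L) (x : F) : R.create (f + g) x = R.create f x + R.create g x := by
  refine R.denseRange_subtype.induction_on x
    (isClosed_eq (by fun_prop) (by fun_prop)) fun y => ?_
  simp [R.create_coe]

theorem create_smul (c : ℂ) (f : L) (x : F) : R.create (c • f) x = c • R.create f x := by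
  refine R.denseRange_subtype.induction_on x
    (isClosed_eq (by fun_prop) (by fun_prop)) fun y => ?_
  simp [R.create_coe]

/-- For fixed `x`, the vector `a†(f) x` as a continuous linear function of `f`. -/
def createAt (x : F) : L →L[ℂ] F :=
  LinearMap.mkContinuous
    { toFun := fun f => R.create f x
      map_add' := fun f g => R.create_add f g x
      map_smul' := fun c f => R.create_smul c f x } ‖x‖
    fun f => by simpa [mul_comm] using R.norm_create_apply_le f x

theorem create_create (f g : L) (x : F) :
    R.create f (R.create g x) = -R.create g (R.create f x) := by
  refine R.denseRange_subtype.induction_on x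
    (isClosed_eq (by fun_prop) (by fun_prop)) fun y => ?_
  have h := congrArg (fun T : Module.End ℂ R.dom => ((T y : R.dom) : F)) (R.cre_cre f g)
  simp only [Submodule.subtype_apply, R.create_coe]
  exact eq_neg_of_add_eq_zero_left (by simpa using h)

theorem annihilate_create (f g : L) (x : F) :
    R.annihilate f (R.create g x)
      = (inner ℂ (J.conj f) g : ℂ) • x - R.create g (R.annihilate f x) := by
  refine R.denseRange_subtype.induction_on x
    (isClosed_eq (by fun_prop) (by fun_prop)) fun y => ?_
  have h := congrArg (fun T : Module.End ℂ R.dom => ((T y : R.dom) : F)) (R.ann_cre f g)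
  simp only [Submodule.subtype_apply, R.create_coe, R.annihilate_coe]
  exact eq_sub_of_add_eq (by simpa using h)

theorem inner_annihilate (f : L) (x y : F) :
    (inner ℂ (R.annihilate f x) y : ℂ) = inner ℂ x (R.create (J.conj f) y) := by
  refine R.denseRange_subtype.induction_on x
    (isClosed_eq (by fun_prop) (by fun_prop)) fun x => ?_
  refine R.denseRange_subtype.induction_on y
    (isClosed_eq (by fun_prop) (by fun_prop)) fun y => ?_
  simpa [R.create_coe, R.annihilate_coe] using R.unitarity f x y

theorem inner_create (f : L) (x y : F) :
    (inner ℂ (R.create f x) y : ℂ) = inner ℂ x (R.annihilate (J.conj f) y) := by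
  rw [← inner_conj_symm, ← inner_conj_symm x, R.inner_annihilate, J.conj_conj]

/-- If `a(f̄) x = 0` for a unit vector `f`, then `a†(f)` preserves inner products with `x`. -/
theorem inner_create_create_self {f : L} (hf : ‖f‖ = 1) {x : F}
    (hx : R.annihilate (J.conj f) x = 0) (y : F) :
    (inner ℂ (R.create f x) (R.create f y) : ℂ) = inner ℂ x y := by
  have h : R.annihilate (J.conj f) (R.create f x) = x := by
    rw [R.annihilate_create, hx, J.conj_conj, inner_self_eq_norm_sq_to_K, hf]
    simp
  have h2 := R.inner_annihilate (J.conj f) (R.create f x) y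
  rw [J.conj_conj, h] at h2
  exact h2.symm

theorem inner_create_create_of_annihilate_eq_zero {f : L} {x : F}
    (hx : R.annihilate (J.conj f) x = 0) (g : L) :
    (inner ℂ (R.create f x) (R.create g x) : ℂ) = inner ℂ f g * inner ℂ x x := by
  rw [R.inner_create, R.annihilate_create, hx, J.conj_conj]
  simp

end CARRepresentation

/-! ### Slater determinants, second quantization and the number operator. -/

namespace FockRepresentation

variable {L : Type*} [NormedAddCommGroup L] [InnerProductSpace ℂ L] {J : Conjugation L}
  {F : Type*} [NormedAddCommGroup F] [InnerProductSpace ℂ F] [CompleteSpace F]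
  (R : FockRepresentation L J F) {ι : Type*} (e : HilbertBasis ι ℂ L)

theorem createList_mem_nParticle (l : List L) :
    R.createList R.vacuum l ∈ R.nParticle l.length :=
  Submodule.le_topologicalClosure _ (Submodule.subset_span ⟨l, rfl, rfl⟩)

theorem createList_mem_finiteParticle (l : List L) :
    R.createList R.vacuum l ∈ R.finiteParticle :=
  le_iSup R.nParticle l.length (R.createList_mem_nParticle l)

theorem annihilate_createList_of_forall_inner_eq_zero {f : L} {l : List L}
    (h : ∀ g ∈ l, (inner ℂ f g : ℂ) = 0) :
    R.annihilate (J.conj f) (R.createList R.vacuum l) = 0 := by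
  induction l with
  | nil => exact R.annihilate_vacuum _
  | cons g l ih =>
    rw [CARRepresentation.createList, R.annihilate_create, J.conj_conj, h g (by simp),
      ih fun g' hg' => h g' (by simp [hg'])]
    simp

/-- The vector `x` is in the domain of `dΓ(B)` and `dΓ(B) x = y`. -/
def HasDGamma (B : L →L[ℂ] L) (x y : F) : Prop :=
  HasSum (fun j => R.create (B (e j)) (R.annihilate (J.conj (e j)) x)) y

variable {R e}

theorem HasDGamma.dGamma_eq {B : L →L[ℂ] L} {x y : F} (h : R.HasDGamma e B x y) :
    R.dGamma e B x = y :=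
  h.tsum_eq

theorem hasDGamma_vacuum (B : L →L[ℂ] L) : R.HasDGamma e B R.vacuum 0 := by
  simp [HasDGamma, R.annihilate_vacuum, hasSum_zero]

/-- `dΓ(B) a†(f) = a†(B f) + a†(f) dΓ(B)`. -/
theorem HasDGamma.create {B : L →L[ℂ] L} {x y : F} (h : R.HasDGamma e B x y) (f : L) :
    R.HasDGamma e B (R.create f x) (R.create (B f) x + R.create f y) := by
  have h1 := ((R.createAt x).comp B).hasSum (e.hasSum_repr f)
  have h2 := (R.create f).hasSum h
  -- Moving `a†(f)` to the left past `a(ēⱼ)` and `a†(B eⱼ)` changes the sign twice and leaves the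
  -- contraction `(eⱼ, f) a†(B eⱼ)`; these contractions sum to `a†(B f)`.
  refine (h1.add h2).congr_fun fun j => ?_
  rw [R.annihilate_create, J.conj_conj, map_sub, map_smul, R.create_create (B (e j)) f,
    sub_neg_eq_add, e.repr_apply_apply, map_smul]
  rfl

theorem hasDGamma_id_createList (l : List L) :
    R.HasDGamma e (ContinuousLinearMap.id ℂ L) (R.createList R.vacuum l)
      ((l.length : ℂ) • R.createList R.vacuum l) := by
  induction l with
  | nil => simpa using! hasDGamma_vacuum _
  | cons f l ih =>
    have h := ih.create f
    rw [CARRepresentation.createList]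
    convert! h using 1
    simp [add_smul, add_comm]

theorem norm_createList_map {κ : Type*} {v : κ → L} (hv : Orthonormal ℂ v) {l : List κ}
    (hl : l.Nodup) : ‖R.createList R.vacuum (l.map v)‖ = 1 := by
  induction l with
  | nil => exact R.norm_vacuum
  | cons i l ih =>
    rw [List.nodup_cons] at hl
    have h0 : R.annihilate (J.conj (v i)) (R.createList R.vacuum (l.map v)) = 0 := by
      refine R.annihilate_createList_of_forall_inner_eq_zero fun g hg => ?_
      obtain ⟨j, hj, rfl⟩ := List.mem_map.1 hg
      exact hv.2 fun hij => hl.1 (hij ▸ hj)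
    have h := R.inner_create_create_self (hv.1 i) h0 (R.createList R.vacuum (l.map v))
    rw [inner_self_eq_norm_sq_to_K, inner_self_eq_norm_sq_to_K, ih hl.2] at h
    have h' : ‖R.create (v i) (R.createList R.vacuum (l.map v))‖ ^ 2 = 1 ^ 2 := by
      exact_mod_cast h
    exact (pow_left_inj₀ (norm_nonneg _) zero_le_one two_ne_zero).1 h'

/-- The expectation of `dΓ(B)` in a Slater determinant is a partial trace of `B`. -/
theorem exists_hasDGamma_createList_map (B : L →L[ℂ] L) {κ : Type*} {v : κ → L}
    (hv : Orthonormal ℂ v) {l : List κ} (hl : l.Nodup) :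
    ∃ y, R.HasDGamma e B (R.createList R.vacuum (l.map v)) y ∧
      (inner ℂ (R.createList R.vacuum (l.map v)) y : ℂ)
        = (l.map fun i => (inner ℂ (v i) (B (v i)) : ℂ)).sum := by
  induction l with
  | nil => exact ⟨0, hasDGamma_vacuum B, by simp⟩
  | cons i l ih =>
    rw [List.nodup_cons] at hl
    obtain ⟨y, hy, hy'⟩ := ih hl.2
    have h0 : R.annihilate (J.conj (v i)) (R.createList R.vacuum (l.map v)) = 0 := by
      refine R.annihilate_createList_of_forall_inner_eq_zero fun g hg => ?_
      obtain ⟨j, hj, rfl⟩ := List.mem_map.1 hg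
      exact hv.2 fun hij => hl.1 (hij ▸ hj)
    refine ⟨_, hy.create (v i), ?_⟩
    -- Of the two terms of `dΓ(B) a†(vᵢ)`, the first contributes `(vᵢ, B vᵢ)` and the second the
    -- partial trace already found, both because `a(v̄ᵢ)` kills the remaining determinant.
    rw [List.map_cons, CARRepresentation.createList, inner_add_right,
      R.inner_create_create_of_annihilate_eq_zero h0, R.inner_create_create_self (hv.1 i) h0, hy',
      inner_self_eq_norm_sq_to_K, norm_createList_map hv hl.2]
    simp

/-- Each term `a†(eⱼ) a(ēⱼ)` is symmetric, so the sum is symmetric between any two vectors at which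
the series converges. -/
theorem HasDGamma.inner_id_left {x y x' y' : F}
    (h : R.HasDGamma e (ContinuousLinearMap.id ℂ L) x y)
    (h' : R.HasDGamma e (ContinuousLinearMap.id ℂ L) x' y') :
    (inner ℂ y x' : ℂ) = inner ℂ x y' := by
  have h1 := (innerSL ℂ x).hasSum h'
  have h2 := ((innerSL ℂ x').hasSum h).map (starRingEnd ℂ) Complex.continuous_conj
  rw [innerSL_apply_apply] at h1
  rw [innerSL_apply_apply, inner_conj_symm] at h2
  refine h2.unique (h1.congr_fun fun j => ?_)
  simp only [Function.comp_apply, innerSL_apply_apply, inner_conj_symm]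
  rw [ContinuousLinearMap.id_apply, R.inner_create,
    R.inner_annihilate, J.conj_conj]

theorem starProjection_numberEigenspace_createList (l : List L) :
    (R.numberEigenspace e l.length).starProjection (R.createList R.vacuum l)
      = R.createList R.vacuum l := by
  rw [Submodule.starProjection_eq_self_iff]
  exact Submodule.le_topologicalClosure _ (Submodule.subset_span
    ⟨R.createList_mem_finiteParticle l, (hasDGamma_id_createList l).dGamma_eq⟩)

/-- Eigenvectors of a symmetric operator for distinct eigenvalues are orthogonal. The case `m = 0`
is left out because a divergent series has `tsum` equal to `0` and would pass for an eigenvector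
with eigenvalue `0`. -/
theorem starProjection_numberEigenspace_createList_eq_zero (l : List L) {m : ℕ} (hm : m ≠ 0)
    (hml : m ≠ l.length) :
    (R.numberEigenspace e m).starProjection (R.createList R.vacuum l) = 0 := by
  rw [Submodule.starProjection_apply_eq_zero_iff]
  have : (R.numberEigenspace e m)ᗮ = (Submodule.span ℂ
    {Φ | Φ ∈ R.finiteParticle ∧ R.number e Φ = (m : ℂ) • Φ})ᗮ :=
      Submodule.orthogonal_closure _
  rw [this, Submodule.mem_orthogonal]
  suffices H : ∀ Φ : F, R.number e Φ = (m : ℂ) • Φ →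
      (inner ℂ Φ (R.createList R.vacuum l) : ℂ) = 0 by
    intro Φ hΦ
    induction hΦ using Submodule.span_induction with
    | mem Φ hΦ => exact H Φ hΦ.2
    | zero => simp
    | add x y _ _ hx hy => rw [inner_add_left, hx, hy, add_zero]
    | smul c x _ hx => rw [inner_smul_left, hx, mul_zero]
  intro Φ hΦ
  by_cases h0 : Φ = 0
  · simp [h0]
  have hs : R.HasDGamma e (ContinuousLinearMap.id ℂ L) Φ ((m : ℂ) • Φ) := by
    by_cases hsum : Summable fun j =>
      R.create (ContinuousLinearMap.id ℂ L (e j)) (R.annihilate (J.conj (e j)) Φ)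
    · rw [← hΦ]; exact hsum.hasSum
    · have : R.number e Φ = 0 := tsum_eq_zero_of_not_summable hsum
      rw [hΦ] at this
      simp_all
  have h := hs.inner_id_left (hasDGamma_id_createList l)
  rw [inner_smul_left, inner_smul_right] at h
  have hne : (m : ℂ) - (l.length : ℂ) ≠ 0 := by
    rw [sub_ne_zero]; exact_mod_cast hml
  have h2 : ((m : ℂ) - (l.length : ℂ)) * inner ℂ Φ (R.createList R.vacuum l) = 0 := by
    rw [sub_mul, sub_eq_zero]; simpa using h
  exact (mul_eq_zero.1 h2).resolve_left hne

/-- Only the terms `0` and `l.length` of the spectral sum can be nonzero. The summand `1` absorbs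
the term `0`, whose weight `0 ^ s` is `0` or `1`. -/
theorem norm_numberPow_createList_le {l : List L} (hl : l ≠ [])
    (hn : ‖R.createList R.vacuum l‖ = 1) (s : ℝ) :
    ‖R.numberPow e s (R.createList R.vacuum l)‖ ≤ (l.length : ℝ) ^ s + 1 := by
  have hlen : l.length ≠ 0 := by simpa using hl
  have hsum : R.numberPow e s (R.createList R.vacuum l)
      = ∑ n ∈ {0, l.length}, (((n : ℝ) ^ s : ℝ) : ℂ) •
          (R.numberEigenspace e n).starProjection (R.createList R.vacuum l) := by
    refine tsum_eq_sum fun m hm => ?_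
    simp only [Finset.mem_insert, Finset.mem_singleton, not_or] at hm
    rw [starProjection_numberEigenspace_createList_eq_zero l hm.1 hm.2, smul_zero]
  rw [hsum, Finset.sum_pair hlen.symm, starProjection_numberEigenspace_createList, add_comm]
  have h0 : |((0 : ℕ) : ℝ) ^ s| ≤ 1 := by
    by_cases hs : s = 0
    · simp [hs]
    · simp [Real.zero_rpow hs]
  refine (norm_add_le _ _).trans (add_le_add ?_ ?_)
  · rw [norm_smul, hn, mul_one, Complex.norm_real, Real.norm_of_nonneg (by positivity)]
  · rw [norm_smul, Complex.norm_real]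
    refine mul_le_one₀ h0 (norm_nonneg _) ?_
    rw [← hn]
    exact Submodule.norm_starProjection_apply_le _ _

/-- A number bound on `dΓ(B)` bounds the partial traces of `B` over orthonormal systems. -/
theorem NumberBound.norm_sum_inner_sq_le {B : L →L[ℂ] L} {γ δ s : ℝ}
    (hB : R.NumberBound e B γ δ s) {κ : Type*} {v : κ → L} (hv : Orthonormal ℂ v)
    (S : Finset κ) :
    ‖∑ i ∈ S, (inner ℂ (v i) (B (v i)) : ℂ)‖ ^ 2 ≤ |γ| * ((S.card : ℝ) ^ s + 1) + |δ| := by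
  rcases S.eq_empty_or_nonempty with rfl | hS
  · rw [Finset.sum_empty, norm_zero, zero_pow two_ne_zero]
    positivity
  set l := S.toList.map v with hl
  have hn : ‖R.createList R.vacuum l‖ = 1 := norm_createList_map hv S.nodup_toList
  have hlen : l.length = S.card := by simp [hl]
  have hne : l ≠ [] := by simpa [hl] using hS.ne_empty
  obtain ⟨y, hy, hy'⟩ := exists_hasDGamma_createList_map (R := R) (e := e) B hv S.nodup_toList
  rw [Finset.sum_map_toList, ← hl] at hy'
  have h1 := hB _ (R.createList_mem_finiteParticle l)
  rw [hy.dGamma_eq] at h1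
  have h2 : ‖∑ i ∈ S, (inner ℂ (v i) (B (v i)) : ℂ)‖ ≤ ‖y‖ := by
    rw [← hy']
    simpa [hn] using norm_inner_le_norm (𝕜 := ℂ) (R.createList R.vacuum l) y
  have h3 := norm_numberPow_createList_le (e := e) hne hn s
  rw [hlen] at h3
  calc _ ≤ ‖y‖ ^ 2 := by gcongr
    _ ≤ _ := h1
    _ ≤ ‖(γ : ℂ) • R.numberPow e s (R.createList R.vacuum l)
          + (δ : ℂ) • R.createList R.vacuum l‖ := by
        refine (Complex.re_le_norm _).trans ?_
        refine (norm_inner_le_norm _ _).trans (le_of_eq ?_)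
        rw [hn, one_mul]
    _ ≤ |γ| * ‖R.numberPow e s (R.createList R.vacuum l)‖ + |δ| := by
        refine (norm_add_le _ _).trans (le_of_eq ?_)
        simp [norm_smul, hn]
    _ ≤ _ := by gcongr

end FockRepresentation

/-! ### From partial traces to off-diagonal sums. -/

section Trace

variable {L : Type*} [NormedAddCommGroup L] [InnerProductSpace ℂ L]

/-- If all partial sums of a finite family of reals are bounded by `D` in absolute value, then so
is half the sum of the absolute values. -/
theorem Finset.sum_abs_le_two_mul_of_forall_abs_sum_le {κ : Type*} {S : Finset κ} {b : κ → ℝ}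
    {D : ℝ} (h : ∀ T ⊆ S, |∑ i ∈ T, b i| ≤ D) : ∑ i ∈ S, |b i| ≤ 2 * D := by
  rw [← Finset.sum_filter_add_sum_filter_not S (fun i => 0 ≤ b i)]
  have h1 := (le_abs_self _).trans (h _ (Finset.filter_subset (fun i => 0 ≤ b i) S))
  have h2 := (neg_le_abs _).trans (h _ (Finset.filter_subset (fun i => ¬ 0 ≤ b i) S))
  rw [Finset.sum_congr rfl fun i hi => abs_of_nonneg (Finset.mem_filter.1 hi).2,
    Finset.sum_congr rfl fun i hi => abs_of_nonpos (not_le.1 (Finset.mem_filter.1 hi).2).le,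
    Finset.sum_neg_distrib]
  linarith

theorem Finset.sum_norm_le_four_mul_of_forall_norm_sum_le {κ : Type*} {S : Finset κ} {b : κ → ℂ}
    {D : ℝ} (h : ∀ T ⊆ S, ‖∑ i ∈ T, b i‖ ≤ D) : ∑ i ∈ S, ‖b i‖ ≤ 4 * D := by
  have h1 : ∑ i ∈ S, |(b i).re| ≤ 2 * D := sum_abs_le_two_mul_of_forall_abs_sum_le fun T hT => by
    simpa using (Complex.abs_re_le_norm _).trans (h T hT)
  have h2 : ∑ i ∈ S, |(b i).im| ≤ 2 * D := sum_abs_le_two_mul_of_forall_abs_sum_le fun T hT => by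
    simpa using (Complex.abs_im_le_norm _).trans (h T hT)
  calc _ ≤ ∑ i ∈ S, (|(b i).re| + |(b i).im|) :=
        Finset.sum_le_sum fun i _ => Complex.norm_le_abs_re_add_abs_im _
    _ ≤ _ := by rw [Finset.sum_add_distrib]; linarith

/-- The partial traces of `B` over subsystems of finite orthonormal systems with `n` elements are
bounded by `D n`. -/
def PartialTraceBound (B : L →L[ℂ] L) (D : ℕ → ℝ) : Prop :=
  ∀ (d : ℕ) (v : Fin d → L), Orthonormal ℂ v → ∀ S : Finset (Fin d),
    ‖∑ i ∈ S, (inner ℂ (v i) (B (v i)) : ℂ)‖ ≤ D S.card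

variable {B : L →L[ℂ] L} {D : ℕ → ℝ}

/-- The sum is the trace of `B H` for the self-adjoint `H = ∑ (gⱼ, ·) fⱼ + (fⱼ, ·) gⱼ`, which lives
on a space of dimension at most `2 * S.card`. In an eigenbasis `h` it becomes `∑ λₖ (hₖ, B hₖ)`. The
constant is `8 = 2 * 4`: `|λₖ| ≤ 2`, and `4` is the cost of putting absolute values inside the sum.
-/
theorem PartialTraceBound.norm_sum_inner_add_inner_le (hB : PartialTraceBound B D)
    (hD : Monotone D) {κ : Type*} {f g : κ → L} (hf : Orthonormal ℂ f) (hg : Orthonormal ℂ g)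
    (S : Finset κ) :
    ‖∑ j ∈ S, ((inner ℂ (g j) (B (f j)) : ℂ) + inner ℂ (f j) (B (g j)))‖
      ≤ 8 * D (2 * S.card) := by
  classical
  let V : Submodule ℂ L := Submodule.span ℂ (S.image f ∪ S.image g : Finset L)
  have hfV : ∀ j ∈ S, f j ∈ V := fun j hj => Submodule.subset_span (by
    simp only [Finset.coe_union, Finset.coe_image]; exact Or.inl ⟨j, hj, rfl⟩)
  have hgV : ∀ j ∈ S, g j ∈ V := fun j hj => Submodule.subset_span (by
    simp only [Finset.coe_union, Finset.coe_image]; exact Or.inr ⟨j, hj, rfl⟩)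
  have hdim : Module.finrank ℂ V ≤ 2 * S.card := by
    refine (finrank_span_finset_le_card _).trans ((Finset.card_union_le _ _).trans ?_)
    have h1 := Finset.card_image_le (s := S) (f := f)
    have h2 := Finset.card_image_le (s := S) (f := g)
    omega
  let H₀ : L →ₗ[ℂ] L := ∑ j ∈ S, ((innerₛₗ ℂ (g j)).smulRight (f j)
    + (innerₛₗ ℂ (f j)).smulRight (g j))
  have hH₀ : ∀ x, H₀ x = ∑ j ∈ S, ((inner ℂ (g j) x : ℂ) • f j + (inner ℂ (f j) x : ℂ) • g j) := by
    intro x; simp [H₀]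
  let H : V →ₗ[ℂ] V := (H₀.comp V.subtype).codRestrict V fun x => by
    rw [LinearMap.comp_apply, hH₀]
    exact V.sum_mem fun j hj => V.add_mem (V.smul_mem _ (hfV j hj)) (V.smul_mem _ (hgV j hj))
  have hH : ∀ x : V, ((H x : V) : L)
      = ∑ j ∈ S, ((inner ℂ (g j) (x : L) : ℂ) • f j + (inner ℂ (f j) (x : L) : ℂ) • g j) :=
    fun x => hH₀ x
  have hsymm : H.IsSymmetric := by
    intro x y
    rw [Submodule.coe_inner, Submodule.coe_inner, hH, hH, sum_inner, inner_sum]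
    refine Finset.sum_congr rfl fun j _ => ?_
    simp only [inner_add_left, inner_add_right, inner_smul_left, inner_smul_right,
      inner_conj_symm]
    ring
  have : FiniteDimensional ℂ V := FiniteDimensional.span_finset ℂ _
  let h := hsymm.eigenvectorBasis rfl
  let lam := hsymm.eigenvalues rfl
  have hHh : ∀ k, ((H (h k) : V) : L) = (lam k : ℂ) • (h k : L) := fun k => by
    rw [hsymm.apply_eigenvectorBasis rfl k]; rfl
  have hON : Orthonormal ℂ fun k => (h k : L) := h.orthonormal.comp_linearIsometry V.subtypeₗᵢ
  -- By `2ab ≤ a² + b²` and Bessel's inequality for `f` and for `g`.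
  have hlam : ∀ k, |lam k| ≤ 2 := by
    intro k
    have h1 : (inner ℂ (h k : L) ((H (h k) : V) : L) : ℂ) = lam k := by
      rw [hHh, inner_smul_right, inner_self_eq_norm_sq_to_K, hON.1 k]; simp
    have h2 := hf.sum_inner_products_le (h k : L) (s := S)
    have h3 := hg.sum_inner_products_le (h k : L) (s := S)
    rw [hON.1 k] at h2 h3
    rw [← Real.norm_eq_abs, ← Complex.norm_real, ← h1, hH, inner_sum]
    calc _ ≤ ∑ j ∈ S, (‖(inner ℂ (f j) (h k : L) : ℂ)‖ ^ 2
              + ‖(inner ℂ (g j) (h k : L) : ℂ)‖ ^ 2) := by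
          refine norm_sum_le_of_le _ fun j _ => ?_
          rw [inner_add_right, inner_smul_right, inner_smul_right]
          refine (norm_add_le _ _).trans ?_
          rw [norm_mul, norm_mul, norm_inner_symm (h k : L) (f j), norm_inner_symm (h k : L) (g j)]
          nlinarith [sq_nonneg (‖(inner ℂ (f j) (h k : L) : ℂ)‖
              - ‖(inner ℂ (g j) (h k : L) : ℂ)‖)]
      _ ≤ 2 := by rw [Finset.sum_add_distrib]; linarith
  have hparseval : ∀ x : L, ∀ y ∈ V,
      ∑ k, (inner ℂ y (h k : L) : ℂ) * inner ℂ (h k : L) x = inner ℂ y x := by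
    intro x y hy
    have hproj : ∀ z ∈ V, (inner ℂ z x : ℂ) = inner ℂ z (V.starProjection x) := by
      intro z hz
      rw [← Submodule.inner_starProjection_left_eq_right,
        Submodule.starProjection_eq_self_iff.2 hz]
    rw [hproj y hy]
    simp_rw [fun k => hproj _ (h k).2]
    exact h.sum_inner_mul_inner ⟨y, hy⟩ (V.orthogonalProjectionOnto x)
  have htrace : ∑ j ∈ S, ((inner ℂ (g j) (B (f j)) : ℂ) + inner ℂ (f j) (B (g j)))
      = ∑ k, (lam k : ℂ) * inner ℂ (h k : L) (B (h k : L)) := by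
    calc _ = ∑ j ∈ S, ∑ k, ((inner ℂ (g j) (h k : L) : ℂ) * inner ℂ (h k : L) (B (f j))
              + (inner ℂ (f j) (h k : L) : ℂ) * inner ℂ (h k : L) (B (g j))) := by
          refine Finset.sum_congr rfl fun j hj => ?_
          rw [Finset.sum_add_distrib, hparseval _ _ (hgV j hj), hparseval _ _ (hfV j hj)]
      _ = _ := by
          rw [Finset.sum_comm]
          refine Finset.sum_congr rfl fun k _ => ?_
          rw [← inner_smul_right, ← map_smul, ← hHh, hH, map_sum, inner_sum]
          refine Finset.sum_congr rfl fun j _ => ?_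
          simp [inner_add_right, inner_smul_right]
  have hsum : ∑ k, ‖(inner ℂ (h k : L) (B (h k : L)) : ℂ)‖ ≤ 4 * D (2 * S.card) := by
    refine Finset.sum_norm_le_four_mul_of_forall_norm_sum_le fun T _ => ?_
    refine (hB _ _ hON T).trans (hD ?_)
    exact (Finset.card_le_univ T).trans (by simpa using hdim)
  rw [htrace]
  calc _ ≤ ∑ k, 2 * ‖(inner ℂ (h k : L) (B (h k : L)) : ℂ)‖ := by
        refine norm_sum_le_of_le _ fun k _ => ?_
        rw [norm_mul, Complex.norm_real, Real.norm_eq_abs]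
        exact mul_le_mul_of_nonneg_right (hlam k) (norm_nonneg _)
    _ ≤ _ := by rw [← Finset.mul_sum]; linarith

/-- Partial traces control the off-diagonal sums over pairs of orthonormal systems. -/
theorem PartialTraceBound.norm_sum_inner_le (hB : PartialTraceBound B D)
    (hD : Monotone D) {κ : Type*} {f g : κ → L} (hf : Orthonormal ℂ f) (hg : Orthonormal ℂ g)
    (S : Finset κ) :
    ‖∑ j ∈ S, (inner ℂ (g j) (B (f j)) : ℂ)‖ ≤ 8 * D (2 * S.card) := by
  -- Replacing `f` by `i f` turns the symmetrized sum into `i` times the antisymmetrized one. Half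
  -- the sum of the two is the wanted sum, so the constant does not grow.
  have hf' : Orthonormal ℂ fun j => Complex.I • f j := by
    refine ⟨fun j => by simp [norm_smul, hf.1 j], fun i j hij => ?_⟩
    simp [inner_smul_left, inner_smul_right, hf.2 hij]
  have h1 := hB.norm_sum_inner_add_inner_le hD hf hg S
  have h2 := hB.norm_sum_inner_add_inner_le hD hf' hg S
  have h3 : ∑ j ∈ S, ((inner ℂ (g j) (B (Complex.I • f j)) : ℂ)
        + inner ℂ (Complex.I • f j) (B (g j)))
      = Complex.I * ∑ j ∈ S, ((inner ℂ (g j) (B (f j)) : ℂ) - inner ℂ (f j) (B (g j))) := by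
    rw [Finset.mul_sum]
    refine Finset.sum_congr rfl fun j _ => ?_
    rw [map_smul, inner_smul_left, inner_smul_right, Complex.conj_I]
    ring
  rw [h3, norm_mul, Complex.norm_I, one_mul] at h2
  have h4 : (2 : ℂ) * ∑ j ∈ S, (inner ℂ (g j) (B (f j)) : ℂ)
      = ∑ j ∈ S, ((inner ℂ (g j) (B (f j)) : ℂ) + inner ℂ (f j) (B (g j)))
        + ∑ j ∈ S, ((inner ℂ (g j) (B (f j)) : ℂ) - inner ℂ (f j) (B (g j))) := by
    rw [Finset.sum_add_distrib, Finset.sum_sub_distrib]; ring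
  have h5 := norm_add_le
    (∑ j ∈ S, ((inner ℂ (g j) (B (f j)) : ℂ) + inner ℂ (f j) (B (g j))))
    (∑ j ∈ S, ((inner ℂ (g j) (B (f j)) : ℂ) - inner ℂ (f j) (B (g j))))
  rw [← h4, norm_mul] at h5
  simp only [Complex.norm_ofNat] at h5
  linarith

end Trace

/-! ### Compactness from sublinear growth. -/

section Compact

variable {L : Type*} [NormedAddCommGroup L] [InnerProductSpace ℂ L]

theorem isCompactOperator_starProjection (V : Submodule ℂ L) [FiniteDimensional ℂ V] :
    IsCompactOperator V.starProjection := by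
  have : ProperSpace V := FiniteDimensional.proper ℂ V
  exact (isCompactOperator_of_locallyCompactSpace_dom V.orthogonalProjectionOnto).clm_comp V.subtypeL

/-- Either `B` is small off finite-dimensional subspaces, or it has large matrix elements along
arbitrarily long pairs of orthonormal systems. -/
theorem exists_orthonormal_pair_of_forall_finiteDimensional {B : L →L[ℂ] L} {ε : ℝ}
    (h : ∀ V W : Submodule ℂ L, FiniteDimensional ℂ V → FiniteDimensional ℂ W →
      ∃ x ∈ Vᗮ, ∃ y ∈ Wᗮ, ‖x‖ = 1 ∧ ‖y‖ = 1 ∧ ε ≤ (inner ℂ y (B x) : ℂ).re) (n : ℕ) :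
    ∃ f g : Fin n → L, Orthonormal ℂ f ∧ Orthonormal ℂ g ∧
      ∀ j, ε ≤ (inner ℂ (g j) (B (f j)) : ℂ).re := by
  induction n with
  | zero =>
    exact ⟨Fin.elim0, Fin.elim0, ⟨fun i => i.elim0, fun i => i.elim0⟩,
      ⟨fun i => i.elim0, fun i => i.elim0⟩, fun i => i.elim0⟩
  | succ n ih =>
    obtain ⟨f, g, hf, hg, hfg⟩ := ih
    obtain ⟨x, hx, y, hy, hx1, hy1, hxy⟩ := h (Submodule.span ℂ (Set.range f))
      (Submodule.span ℂ (Set.range g)) (FiniteDimensional.span_of_finite ℂ (Set.finite_range f))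
      (FiniteDimensional.span_of_finite ℂ (Set.finite_range g))
    refine ⟨Matrix.vecCons x f, Matrix.vecCons y g, orthonormal_vecCons_iff.2 ⟨hx1, ?_, hf⟩,
      orthonormal_vecCons_iff.2 ⟨hy1, ?_, hg⟩, ?_⟩
    · exact fun i => Submodule.inner_left_of_mem_orthogonal (Submodule.subset_span (Set.mem_range_self i)) hx
    · exact fun i => Submodule.inner_left_of_mem_orthogonal (Submodule.subset_span (Set.mem_range_self i)) hy
    · intro j
      refine Fin.cases ?_ (fun j => ?_) j
      · simpa using hxy
      · simpa using hfg j

/-- After rescaling, test with `y = z`, the image of `x` under the compressed operator: then `(z, B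
P x) = ‖z‖²`, where `P` projects onto `V`, so real parts suffice. -/
theorem norm_starProjection_comp_le_of_forall_re_inner_le {B : L →L[ℂ] L} {ε : ℝ} (hε : 0 ≤ ε)
    (V W : Submodule ℂ L) [V.HasOrthogonalProjection] [W.HasOrthogonalProjection]
    (h : ∀ x ∈ V, ∀ y ∈ W, ‖x‖ = 1 → ‖y‖ = 1 → (inner ℂ y (B x) : ℂ).re ≤ ε) :
    ‖W.starProjection ∘L B ∘L V.starProjection‖ ≤ ε := by
  refine ContinuousLinearMap.opNorm_le_bound _ hε fun x => ?_
  have hhom : ∀ x ∈ V, ∀ y ∈ W, (inner ℂ y (B x) : ℂ).re ≤ ε * ‖x‖ * ‖y‖ := by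
    intro x hx y hy
    rcases eq_or_ne x 0 with rfl | hx0
    · simp
    rcases eq_or_ne y 0 with rfl | hy0
    · simp
    have hxn : ‖x‖ ≠ 0 := norm_ne_zero_iff.2 hx0
    have hyn : ‖y‖ ≠ 0 := norm_ne_zero_iff.2 hy0
    have h1 := h (((‖x‖⁻¹ : ℝ) : ℂ) • x) (V.smul_mem _ hx) (((‖y‖⁻¹ : ℝ) : ℂ) • y)
      (W.smul_mem _ hy) (by simp [norm_smul, hxn]) (by simp [norm_smul, hyn])
    rw [map_smul, inner_smul_left, inner_smul_right, Complex.conj_ofReal, Complex.re_ofReal_mul,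
      Complex.re_ofReal_mul] at h1
    field_simp at h1
    linarith
  set z := (W.starProjection ∘L B ∘L V.starProjection) x with hz
  have hzW : z ∈ W := Submodule.starProjection_apply_mem _ _
  have h1 := hhom _ (V.starProjection_apply_mem x) z hzW
  have h2 : (inner ℂ z (B (V.starProjection x)) : ℂ) = inner ℂ z z := by
    conv_lhs => rw [← Submodule.starProjection_eq_self_iff.2 hzW]
    rw [Submodule.inner_starProjection_left_eq_right]
    rfl
  rw [h2, inner_self_eq_norm_sq_to_K] at h1
  have h3 : ‖z‖ ^ 2 ≤ ε * ‖V.starProjection x‖ * ‖z‖ := by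
    simpa [← Complex.ofReal_pow] using h1
  have h4 : ‖V.starProjection x‖ ≤ ‖x‖ := V.norm_starProjection_apply_le x
  rcases (norm_nonneg z).eq_or_lt with h0 | h0
  · rw [← h0]; positivity
  · have h5 : ‖z‖ ≤ ε * ‖V.starProjection x‖ := le_of_mul_le_mul_right (by linarith) h0
    exact h5.trans (by gcongr)

variable [CompleteSpace L]

/-- An operator whose sums of matrix elements along pairs of orthonormal systems grow sublinearly
is compact. -/
theorem isCompactOperator_of_norm_sum_inner_le {B : L →L[ℂ] L} {D : ℕ → ℝ}
    (hB : ∀ (n : ℕ) (f g : Fin n → L), Orthonormal ℂ f → Orthonormal ℂ g →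
      ‖∑ j, (inner ℂ (g j) (B (f j)) : ℂ)‖ ≤ D n)
    (hD : ∀ ε : ℝ, 0 < ε → ∃ n : ℕ, D n < n * ε) : IsCompactOperator B := by
  have hcl : IsClosed {T : L →L[ℂ] L | IsCompactOperator T} :=
    isClosed_setOfPred_isCompactOperator
  refine hcl.closure_subset (Metric.mem_closure_iff.2 fun ε hε => ?_)
  -- If large matrix elements survive off all finite-dimensional subspaces, orthonormal systems of
  -- length `n` give a sum of at least `n * (ε / 2)`, against `hD`. Otherwise cutting off one pair
  -- `V`, `W` leaves an operator of norm at most `ε / 2`, and the part removed is compact.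
  by_cases h : ∀ V W : Submodule ℂ L, FiniteDimensional ℂ V → FiniteDimensional ℂ W →
      ∃ x ∈ Vᗮ, ∃ y ∈ Wᗮ, ‖x‖ = 1 ∧ ‖y‖ = 1 ∧ ε / 2 ≤ (inner ℂ y (B x) : ℂ).re
  · exfalso
    obtain ⟨n, hn⟩ := hD (ε / 2) (by positivity)
    obtain ⟨f, g, hf, hg, hfg⟩ := exists_orthonormal_pair_of_forall_finiteDimensional h n
    have h1 := (Complex.re_le_norm _).trans (hB n f g hf hg)
    rw [Complex.re_sum] at h1
    have h2 : (n : ℝ) * (ε / 2) ≤ ∑ j, (inner ℂ (g j) (B (f j)) : ℂ).re := by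
      simpa using Finset.card_nsmul_le_sum Finset.univ _ _ fun j _ => hfg j
    linarith
  · push Not at h
    obtain ⟨V, W, hV, hW, h⟩ := h
    refine ⟨B ∘L V.starProjection + W.starProjection ∘L B ∘L Vᗮ.starProjection, ?_, ?_⟩
    · exact ((isCompactOperator_starProjection V).clm_comp B).add
        ((isCompactOperator_starProjection W).comp_clm (B ∘L Vᗮ.starProjection))
    · have h1 : B - (B ∘L V.starProjection + W.starProjection ∘L B ∘L Vᗮ.starProjection)
          = Wᗮ.starProjection ∘L B ∘L Vᗮ.starProjection := by
        ext x
        simp [Submodule.starProjection_orthogonal']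
        abel
      rw [dist_eq_norm, h1]
      refine (norm_starProjection_comp_le_of_forall_re_inner_le (half_pos hε).le _ _
        fun x hx y hy hx1 hy1 => (h x hx y hy hx1 hy1).le).trans_lt (half_lt_self hε)

end Compact

/-! ### Singular value decomposition of compact operators. -/

section SingularValues

universe w

variable {L : Type w} [NormedAddCommGroup L] [InnerProductSpace ℂ L] [CompleteSpace L]

/-- Join Hilbert bases of all eigenspaces, the kernel included. Completeness of the union is the
spectral theorem for compact self-adjoint operators. -/
theorem exists_hilbertBasis_eigenvectors {T : L →L[ℂ] L} (hT : IsCompactOperator T)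
    (hT' : T.IsSymmetric) :
    ∃ (κ : Type w) (b : HilbertBasis κ ℂ L), ∀ k, ∃ c : ℂ, T (b k) = c • b k := by
  let E : ℂ → Submodule ℂ L := fun c => Module.End.eigenspace (T : Module.End ℂ L) c
  have hE : ∀ c, CompleteSpace (E c) := fun c => by
    refine IsClosed.completeSpace_coe (hs := ?_)
    have : (E c : Set L) = {x | T x = c • x} := by
      ext x; exact Module.End.mem_eigenspace_iff
    rw [this]
    exact isClosed_eq T.continuous (by fun_prop)
  choose w b hb using fun c => exists_hilbertBasis ℂ (E c)
  let v : (Σ c, w c) → L := fun a => (b a.1 a.2 : L)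
  have hv : Orthonormal ℂ v :=
    hT'.orthogonalFamily_eigenspaces.orthonormal_sigma_orthonormal fun c => (b c).orthonormal
  have hbot : (Submodule.span ℂ (Set.range v))ᗮ = ⊥ := by
    rw [eq_bot_iff, ← T.orthogonalComplement_iSup_eigenspaces_eq_bot hT hT']
    intro x hx
    rw [Submodule.mem_orthogonal'] at hx ⊢
    have hx' : ⨆ c, E c ≤ (ℂ ∙ x)ᗮ := by
      refine iSup_le fun c y hy => ?_
      rw [Submodule.mem_orthogonal_singleton_iff_inner_right]
      have h1 := ((innerSL ℂ x).comp (E c).subtypeL).hasSum ((b c).hasSum_repr ⟨y, hy⟩)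
      have h2 : ∀ i, ((innerSL ℂ x).comp (E c).subtypeL) ((b c).repr ⟨y, hy⟩ i • b c i) = 0 := by
        intro i
        rw [map_smul]
        have := hx (v ⟨c, i⟩) (Submodule.subset_span (Set.mem_range_self _))
        simp only [ContinuousLinearMap.comp_apply, Submodule.subtypeL_apply, innerSL_apply_apply]
        rw [show (inner ℂ x (b c i : L) : ℂ) = 0 from this, smul_zero]
      simp only [h2] at h1
      exact (hasSum_zero.unique h1).symm
    exact fun y hy => Submodule.mem_orthogonal_singleton_iff_inner_right.1 (hx' hy)
  refine ⟨_, HilbertBasis.mkOfOrthogonalEqBot hv hbot, fun k => ⟨k.1, ?_⟩⟩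
  rw [HilbertBasis.coe_mkOfOrthogonalEqBot]
  exact Module.End.mem_eigenspace_iff.1 (b k.1 k.2).2

/-- The singular value decomposition of a compact operator. -/
theorem IsCompactOperator.exists_singularValueDecomposition {B : L →L[ℂ] L}
    (hB : IsCompactOperator B) :
    ∃ (κ : Type w) (μ : κ → ℝ) (e f : κ → L),
      (∀ j, 0 ≤ μ j) ∧ Orthonormal ℂ e ∧ Orthonormal ℂ f ∧ (∀ j, B (e j) = (μ j : ℂ) • f j) ∧
      ∀ x, HasSum (fun j => ((μ j : ℂ) * inner ℂ (e j) x) • f j) (B x) := by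
  let T : L →L[ℂ] L := ContinuousLinearMap.adjoint B ∘L B
  have hT : IsCompactOperator T := hB.clm_comp (ContinuousLinearMap.adjoint B)
  have hTin : ∀ x y, (inner ℂ (B x) (B y) : ℂ) = inner ℂ x (T y) := fun x y => by
    simp [T, ContinuousLinearMap.adjoint_inner_right]
  have hT' : T.IsSymmetric := fun x y => by
    simp [T, ContinuousLinearMap.adjoint_inner_right, ContinuousLinearMap.adjoint_inner_left]
  obtain ⟨κ, b, hb⟩ := exists_hilbertBasis_eigenvectors hT hT'
  have hBf : ∀ j : {k // B (b k) ≠ 0},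
      B (b j) = (‖B (b j)‖ : ℂ) • ((‖B (b j)‖⁻¹ : ℝ) : ℂ) • B (b j) := by
    intro j
    have : (‖B (b j)‖ : ℂ) ≠ 0 := by exact_mod_cast norm_ne_zero_iff.2 j.2
    rw [smul_smul, Complex.ofReal_inv, mul_inv_cancel₀ this, one_smul]
  -- Basis vectors in the kernel of `B` are dropped, and the other images are normalized. The images
  -- are orthogonal since `(B bᵢ, B bⱼ) = (bᵢ, T bⱼ)` and `bⱼ` is an eigenvector of `T = B* B`.
  refine ⟨{k // B (b k) ≠ 0}, fun j => ‖B (b j)‖, fun j => b j,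
    fun j => ((‖B (b j)‖⁻¹ : ℝ) : ℂ) • B (b j), fun j => norm_nonneg _,
    b.orthonormal.comp _ Subtype.val_injective, ⟨fun j => ?_, fun i j hij => ?_⟩, hBf, fun x => ?_⟩
  · have : ‖B (b j)‖ ≠ 0 := norm_ne_zero_iff.2 j.2
    simp [norm_smul, this]
  · obtain ⟨c, hc⟩ := hb j
    have hij' : (i : κ) ≠ j := fun h => hij (Subtype.ext h)
    simp only [inner_smul_left, inner_smul_right, hTin, hc, b.orthonormal.2 hij', mul_zero]
  · have h1 := B.hasSum (b.hasSum_repr x)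
    have hsupp : Function.support (fun k => B (b.repr x k • b k)) ⊆ {k | B (b k) ≠ 0} := by
      intro k hk h0
      exact hk (by simp [h0])
    refine ((hasSum_subtype_iff_of_support_subset hsupp).2 h1).congr_fun fun j => ?_
    rw [mul_comm, mul_smul, ← hBf]
    simp [b.repr_apply_apply]

end SingularValues

/-! ### Power summability from bounds on finite sums. -/

section Summability

/-- The least of `n` values is at most their mean, hence at most `C n^(-1/r)`. Removing it and
inducting on `n` compares the sum of `p`-th powers with `∑ C^p k^(-p/r)`, which converges as `p >
r`; no ordering of the family is needed. -/
theorem summable_rpow_of_sum_le_mul_card_rpow {κ : Type*} {μ : κ → ℝ} (hμ : ∀ j, 0 ≤ μ j)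
    {C r p : ℝ} (hr : 0 < r) (hrp : r < p)
    (h : ∀ S : Finset κ, S.Nonempty → ∑ j ∈ S, μ j ≤ C * (S.card : ℝ) ^ (1 - 1 / r)) :
    Summable fun j => μ j ^ p := by
  have hp : 0 < p := hr.trans hrp
  have key : ∀ n : ℕ, ∀ S : Finset κ, S.card = n →
      ∑ j ∈ S, μ j ^ p ≤ ∑ k ∈ Finset.range n, C ^ p * ((k + 1 : ℕ) : ℝ) ^ (-(p / r)) := by
    classical
    intro n
    induction n with
    | zero => intro S hS; simp [Finset.card_eq_zero.1 hS]
    | succ n ih =>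
      intro S hS
      have hne : S.Nonempty := Finset.card_pos.1 (by omega)
      obtain ⟨m, hm, hmin⟩ := S.exists_min_image μ hne
      have hn : (0 : ℝ) < ((n + 1 : ℕ) : ℝ) := by positivity
      have h1 : ((n + 1 : ℕ) : ℝ) * μ m ≤ C * ((n + 1 : ℕ) : ℝ) ^ (1 - 1 / r) := by
        rw [← hS]
        refine le_trans ?_ (h S hne)
        simpa using Finset.card_nsmul_le_sum S μ (μ m) hmin
      have h2 : μ m ≤ C * ((n + 1 : ℕ) : ℝ) ^ (-(1 / r)) := by
        rw [sub_eq_add_neg, Real.rpow_add hn, Real.rpow_one] at h1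
        refine le_of_mul_le_mul_left ?_ hn
        linarith
      have hC : 0 ≤ C := by
        by_contra hC
        have := mul_neg_of_neg_of_pos (not_le.1 hC) (Real.rpow_pos_of_pos hn (-(1 / r)))
        linarith [hμ m]
      rw [← Finset.sum_erase_add S _ hm, Finset.sum_range_succ]
      refine add_le_add (ih _ (by rw [Finset.card_erase_of_mem hm, hS]; rfl)) ?_
      refine (Real.rpow_le_rpow (hμ m) h2 hp.le).trans (le_of_eq ?_)
      rw [Real.mul_rpow hC (by positivity), ← Real.rpow_mul hn.le]
      congr 2
      ring
  have hsum : Summable fun k : ℕ => C ^ p * ((k + 1 : ℕ) : ℝ) ^ (-(p / r)) := by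
    refine Summable.mul_left _ ?_
    refine (summable_nat_add_iff 1).2 (Real.summable_nat_rpow.2 ?_)
    have : 1 < p / r := (one_lt_div hr).2 hrp
    linarith
  refine summable_of_sum_le (c := ∑' k : ℕ, |C ^ p * ((k + 1 : ℕ) : ℝ) ^ (-(p / r))|)
    (fun j => Real.rpow_nonneg (hμ j) p) fun S => ?_
  exact (key _ S rfl).trans ((Finset.sum_le_sum fun k _ => le_abs_self _).trans
    (hsum.abs.sum_le_tsum _ fun k _ => abs_nonneg _))

end Summability

/-! ### Growth rates and the conclusion. -/

section Main

variable {L : Type*} [NormedAddCommGroup L] [InnerProductSpace ℂ L]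

/-- As `n ^ s ≥ 1`, the additive constants are absorbed into a multiple of `n ^ s`. The `2 * n` is
the dimension bound for the span of two systems of `n` vectors. -/
theorem sqrt_add_mul_two_mul_le {γ δ s : ℝ} (hγ : 0 ≤ γ) (hδ : 0 ≤ δ) (hs : 0 ≤ s) {n : ℕ}
    (hn : n ≠ 0) :
    √(γ * (((2 * n : ℕ) : ℝ) ^ s + 1) + δ) ≤ √(γ * (2 ^ s + 1) + δ) * (n : ℝ) ^ (s / 2) := by
  have hn1 : (1 : ℝ) ≤ n := by exact_mod_cast Nat.one_le_iff_ne_zero.2 hn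
  have h1 : (1 : ℝ) ≤ (n : ℝ) ^ s := Real.one_le_rpow hn1 hs
  have h2 : (n : ℝ) ^ (s / 2) = √((n : ℝ) ^ s) := by
    rw [Real.sqrt_eq_rpow, ← Real.rpow_mul (by positivity)]
    congr 1
    ring
  rw [h2, ← Real.sqrt_mul (by positivity)]
  refine Real.sqrt_le_sqrt ?_
  push_cast
  rw [Real.mul_rpow (by norm_num) (by positivity), add_mul, mul_assoc, add_mul, one_mul]
  have h3 : δ ≤ δ * (n : ℝ) ^ s := le_mul_of_one_le_right hδ h1
  have h4 : γ * (2 ^ s * (n : ℝ) ^ s + 1) ≤ γ * (2 ^ s * (n : ℝ) ^ s + (n : ℝ) ^ s) := by gcongr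
  linarith

theorem exists_mul_rpow_lt_mul (C : ℝ) {a : ℝ} (ha : a < 1) {ε : ℝ} (hε : 0 < ε) :
    ∃ n : ℕ, n ≠ 0 ∧ C * (n : ℝ) ^ a < n * ε := by
  have h1 : Filter.Tendsto (fun n : ℕ => C * (n : ℝ) ^ (-(1 - a))) Filter.atTop (nhds (C * 0)) :=
    ((tendsto_rpow_neg_atTop (by linarith)).comp tendsto_natCast_atTop_atTop).const_mul C
  rw [mul_zero] at h1
  obtain ⟨n, hn, hn0⟩ := ((h1.eventually_lt_const hε).and (Filter.eventually_ne_atTop 0)).exists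
  refine ⟨n, hn0, ?_⟩
  have hn' : (0 : ℝ) < n := by positivity
  have h2 : (n : ℝ) ^ a = n * (n : ℝ) ^ (-(1 - a)) := by
    rw [show a = 1 + -(1 - a) by ring, Real.rpow_add hn', Real.rpow_one]
    congr 2
    ring
  rw [h2, mul_left_comm]
  exact mul_lt_mul_of_pos_left hn hn'

theorem FockRepresentation.NumberBound.partialTraceBound {J : Conjugation L}
    {F : Type*} [NormedAddCommGroup F] [InnerProductSpace ℂ F] [CompleteSpace F]
    {R : FockRepresentation L J F} {ι : Type*} {e : HilbertBasis ι ℂ L}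
    {B : L →L[ℂ] L} {γ δ s : ℝ} (hB : R.NumberBound e B γ δ s) :
    PartialTraceBound B fun n => √(|γ| * ((n : ℝ) ^ s + 1) + |δ|) :=
  fun _ _ hv S => Real.le_sqrt_of_sq_le (hB.norm_sum_inner_sq_le hv S)

end Main

end

theorem mainTheorem4 {L : Type*} [NormedAddCommGroup L] [InnerProductSpace ℂ L] [CompleteSpace L]
    [TopologicalSpace.SeparableSpace L] (hL : ¬ FiniteDimensional ℂ L) (J : Conjugation L)
    {F : Type*} [NormedAddCommGroup F] [InnerProductSpace ℂ F] [CompleteSpace F]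
    (R : FockRepresentation L J F) {ι : Type*} (e : HilbertBasis ι ℂ L)
    (B : L →L[ℂ] L) (r s γ δ : ℝ) (hr : 1 ≤ r) (hs : s = 2 * (r - 1) / r)
    (hB : R.NumberBound e B γ δ s) :
    (s = 0 → IsSchatten 1 B) ∧
    (0 < s → s < 2 → ∀ ε : ℝ, 0 < ε → IsSchatten (r + ε) B) := by
  have hr0 : 0 < r := by linarith
  have hs2 : s / 2 = 1 - 1 / r := by rw [hs]; field_simp
  have hs0 : 0 ≤ s := by rw [hs]; exact div_nonneg (by linarith) hr0.le
  have hlt : s / 2 < 1 := by rw [hs2]; have := one_div_pos.2 hr0; linarith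
  set D : ℕ → ℝ := fun n => √(|γ| * ((n : ℝ) ^ s + 1) + |δ|) with hD
  have hmono : Monotone D := fun m n hmn => by
    simp only [hD]
    gcongr
  set C : ℝ := 8 * √(|γ| * (2 ^ s + 1) + |δ|) with hC
  have hpair : ∀ {κ : Type _} {f g : κ → L}, Orthonormal ℂ f → Orthonormal ℂ g →
      ∀ S : Finset κ, S.card ≠ 0 →
      ‖∑ j ∈ S, (inner ℂ (g j) (B (f j)) : ℂ)‖ ≤ C * (S.card : ℝ) ^ (s / 2) := by
    intro κ f g hf hg S hS
    refine (hB.partialTraceBound.norm_sum_inner_le hmono hf hg S).trans ?_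
    rw [hC, mul_assoc]
    exact mul_le_mul_of_nonneg_left
      (sqrt_add_mul_two_mul_le (abs_nonneg γ) (abs_nonneg δ) hs0 hS) (by norm_num)
  have hcompact : IsCompactOperator B := by
    refine isCompactOperator_of_norm_sum_inner_le (D := fun n => 8 * D (2 * n))
      (fun n f g hf hg => ?_) fun ε hε => ?_
    · have h := hB.partialTraceBound.norm_sum_inner_le hmono hf hg Finset.univ
      rwa [Finset.card_univ, Fintype.card_fin] at h
    · obtain ⟨n, hn, hlt⟩ := exists_mul_rpow_lt_mul C hlt hε
      refine ⟨n, lt_of_le_of_lt ?_ hlt⟩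
      rw [hC, mul_assoc]
      exact mul_le_mul_of_nonneg_left
        (sqrt_add_mul_two_mul_le (abs_nonneg γ) (abs_nonneg δ) hs0 hn) (by norm_num)
  obtain ⟨κ, μ, u, v, hμ, hu, hv, huv, hsum⟩ := hcompact.exists_singularValueDecomposition
  have hbound : ∀ S : Finset κ, S.Nonempty → ∑ j ∈ S, μ j ≤ C * (S.card : ℝ) ^ (s / 2) := by
    intro S hS
    refine le_trans (le_of_eq ?_) (hpair hu hv S hS.card_ne_zero)
    have : ∀ j, (inner ℂ (v j) (B (u j)) : ℂ) = (μ j : ℂ) := fun j => by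
      rw [huv, inner_smul_right, inner_self_eq_norm_sq_to_K, hv.1 j]; simp
    simp only [this]
    rw [← Complex.ofReal_sum, Complex.norm_real,
      Real.norm_of_nonneg (Finset.sum_nonneg fun j _ => hμ j)]
  refine ⟨fun h0 => ⟨κ, μ, u, v, hμ, hu, hv, hsum, ?_⟩,
    fun _ _ ε hε => ⟨κ, μ, u, v, hμ, hu, hv, hsum, ?_⟩⟩
  -- For `s = 0` the exponent `s / 2` vanishes, so all finite sums of singular values are at most
  -- `C`.
  · simp only [Real.rpow_one]
    refine summable_of_sum_le (c := C) hμ fun S => ?_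
    rcases S.eq_empty_or_nonempty with rfl | hS
    · rw [Finset.sum_empty, hC]; positivity
    · simpa [h0] using hbound S hS
  · exact summable_rpow_of_sum_le_mul_card_rpow hμ hr0 (by linarith) (hs2 ▸ hbound)
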